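/- **Conventions.** A function $\gamma:\mathbb R_+\to\mathbb R_+$ is of class $\mathcal K$ if it is continuous, strictly increasing and $\gamma(0)=0$; it is of class $\mathcal K_\infty$ if in addition $\gamma(s)\to\infty$ as $s\to\infty$. A real function on $\mathbb R^m$ is positive definite if it vanishes at $0$ and is positive elsewhere. $|\cdot|$ is the Euclidean norm. **Setting.** Consider $$\dot w=\Delta_w(w,x),\qquad \dot x=f(x)+g(x)\,[u+\Delta(w,x)],\qquad (w,x)\in\mathbb R^p\times\mathbb R^n,\ u\in\mathbb R,$$ with $f,g:\mathbb R^n\to\mathbb R^n$, $\Delta_w:\mathbb R^p\times\mathbb R^n\to\mathbb R^p$, $\Delta:\mathbb R^p\times\mathbb R^n\to\mathbb R$ locally Lipschitz. Let $r>0$, $Q:\mathbb R^n\to\mathbb R$, and let $C^1$ functions $V_i$ with $V_i(0)=0$ and policies $u_i:\mathbb R^n\to\mathbb R$ ($i=0,1,\dots$) be generated by policy iteration: $$0=\nabla V_i(x)[f(x)+g(x)u_i(x)]+Q(x)+r\,u_i(x)^2,\qquad u_{i+1}(x)=-\tfrac1{2r}\,g(x)^T\nabla V_i(x)^T,\qquad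 x\in\mathbb R^n.$$ Assume: 1. There are $\underline\alpha,\bar\alpha\in\mathcal K_\infty$ with $\underline\alpha(|x|)\le V_i(x)\le\bar\alpha(|x|)$ for all $x\in\mathbb R^n$ and all $i\ge0$, and there is $\epsilon>0$ such that $Q(x)-\epsilon^2|x|^2$ is positive definite. 2. There are $\underline\lambda,\bar\lambda\in\mathcal K_\infty$, $\kappa_1,\kappa_2,\kappa_3\in\mathcal K$, a $C^1$ positive definite function $W$ on $\mathbb R^p$ and a positive definite function $\kappa_4$ on $\mathbb R^p$ such that for all $w\in\mathbb R^p$ and $x\in\mathbb R^n$: $\underline\lambda(|w|)\le W(w)\le\bar\lambda(|w|)$; $|\Delta(w,x)|\le\max\{\kappa_1(|w|),\kappa_2(|x|)\}$; and $W(w)\ge\kappa_3(|x|)$ implies $\nabla W(w)\Delta_w(w,x)\le-\kappa_4(w)$. Let $\rho:[0,\infty)\to\mathbb R$ be smooth, nondecreasing and positive, and put $\gamma(s)=\tfrac12\epsilon\,\rho(s^2)\,s$ for $s\ge0$. Fix an index $i^*$ and $d>0$. Let $\hat u_{i^*+1}=\sum_{j=1}^{N}\hat c_j\phi_j$ with real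 weights $\hat c_j$ and basis functions $\phi_j:\mathbb R^n\to\mathbb R$ such that $\phi_j(0)=0$ and $\phi_j$ is smooth at every point of a set $\Omega\subset\mathbb R^n$ that contains $\{x: V_{i^*}(x)\le d\}$. Put $$u_{ro}(x)=\Big[1+\frac r2\rho^2(|x|^2)\Big]\hat u_{i^*+1}(x),$$ $$e_{ro}(x)=\frac r2\rho^2(|x|^2)\,[\hat u_{i^*+1}(x)-u_{i^*+1}(x)]+\hat u_{i^*+1}(x)-u_{i^*}(x).$$ **Theorem 3.2 (robust redesign, matched uncertainty).** Suppose that $$\gamma(s)>\max\{\kappa_2(s),\ \kappa_1\circ\underline\lambda^{-1}\circ\kappa_3\circ\underline\alpha^{-1}\circ\bar\alpha(s)\}\quad\text{for all } s>0,$$ and that $0<V_{i^*}(x)\le d$ implies $|e_{ro}(x)|<\gamma(|x|)$. Then the closed-loop system $$\dot w=\Delta_w(w,x),\qquad \dot x=f(x)+g(x)[u_{ro}(x)+\Delta(w,x)]$$ is (locally) asymptotically stable at the origin. In addition, there exists $\sigma\in\mathcal K_\infty$ such that $$\Omega_{i^*}=\{(w,x):\max[\sigma(V_{i^*}(x)),W(w)]\le\sigma(d)\}$$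 is an estimate of the region of attraction of the closed-loop system, i.e. it is contained in the region of attraction of the origin: from every point of $\Omega_{i^*}$ a solution exists for all $t\ge0$, and every solution from it converges to the origin. -/

import Mathlib

open Set Filter
open scoped NNReal ContDiff Topology

/-- Class `𝒦`: continuous strictly increasing functions `ℝ₊ → ℝ₊` vanishing at `0`. -/
structure IsClassK (γ : ℝ≥0 → ℝ≥0) : Prop where
  continuous : Continuous γ
  strictMono : StrictMono γ
  map_zero : γ 0 = 0

/-- Class `𝒦∞`: class `𝒦` functions that tend to infinity. -/
structure IsClassKInf (γ : ℝ≥0 → ℝ≥0) : Prop extends IsClassK γ where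
  tendsto_atTop : Tendsto γ atTop atTop

/-- A class `𝒦∞` function is a bijection of `ℝ₊`, so that `Function.invFun γ` is its inverse. -/
theorem IsClassKInf.bijective {γ : ℝ≥0 → ℝ≥0} (h : IsClassKInf γ) : Function.Bijective γ := by
  refine ⟨h.strictMono.injective, fun y => ?_⟩
  obtain ⟨b, hb⟩ := (h.tendsto_atTop.eventually_ge_atTop y).exists
  have hy : y ∈ Icc (γ 0) (γ b) := ⟨by rw [h.map_zero]; exact zero_le, hb⟩
  obtain ⟨x, -, hx⟩ := intermediate_value_Icc (zero_le (a := b)) h.continuous.continuousOn hy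
  exact ⟨x, hx⟩

/-- A positive definite function: zero at the origin and positive everywhere else. -/
def IsPosDefFun {E : Type*} [Zero E] (q : E → ℝ) : Prop :=
  q 0 = 0 ∧ ∀ x, x ≠ 0 → 0 < q x

section ODE

variable {E : Type*} [NormedAddCommGroup E] [NormedSpace ℝ E]

/-- `z` is a solution on `[0, ∞)` of `ż = F(z)` with initial value `z₀`
(one-sided derivative at `t = 0`). -/
def IsSolution (F : E → E) (z₀ : E) (z : ℝ → E) : Prop :=
  z 0 = z₀ ∧ ∀ t ∈ Ici (0 : ℝ), HasDerivWithinAt z (F (z t)) (Ici 0) t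

/-- The region of attraction of the origin for `ż = F(z)`: the initial values from which a
solution exists for all `t ≥ 0`, and every solution converges to the origin. -/
def regionOfAttraction (F : E → E) : Set E :=
  {z₀ | (∃ z, IsSolution F z₀ z) ∧ ∀ z, IsSolution F z₀ z → Tendsto z atTop (𝓝 0)}

/-- Lyapunov stability of the origin for `ż = F(z)`, including existence for all `t ≥ 0` of the
solutions that start near the origin. -/
def IsLyapunovStable (F : E → E) : Prop :=
  ∀ η > 0, ∃ δ > 0, ∀ z₀ : E, ‖z₀‖ < δ →
    (∃ z, IsSolution F z₀ z) ∧ ∀ z, IsSolution F z₀ z → ∀ t, 0 ≤ t → ‖z t‖ < η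

/-- (Local) asymptotic stability of the origin for `ż = F(z)`: the origin is an equilibrium,
it is Lyapunov stable, and it attracts a neighbourhood of itself. -/
def IsAsymptoticallyStable (F : E → E) : Prop :=
  F 0 = 0 ∧ IsLyapunovStable F ∧ regionOfAttraction F ∈ 𝓝 (0 : E)

end ODE

section Control

variable {n p : ℕ}

/-- `(Vᵢ)` and `(uᵢ)` are generated by policy iteration for the system `ẋ = f(x) + g(x) u` and
the cost `∫ (Q(x) + r u²) dt`: for every `i`, the value function `Vᵢ` is `C¹` with `Vᵢ(0) = 0`,
`0 = ∇Vᵢ (f + g uᵢ) + Q + r uᵢ²`, and `uᵢ₊₁ = -(1/(2r)) ∇Vᵢ g`.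
Here `fderiv ℝ (V i) x v` is `∇Vᵢ(x) v`. -/
structure IsPolicyIteration (f g : EuclideanSpace ℝ (Fin n) → EuclideanSpace ℝ (Fin n))
    (Q : EuclideanSpace ℝ (Fin n) → ℝ) (r : ℝ)
    (V u : ℕ → EuclideanSpace ℝ (Fin n) → ℝ) : Prop where
  contDiff : ∀ i, ContDiff ℝ 1 (V i)
  map_zero : ∀ i, V i 0 = 0
  evaluation : ∀ i x, 0 = fderiv ℝ (V i) x (f x + u i x • g x) + Q x + r * u i x ^ 2
  improvement : ∀ i x, u (i + 1) x = -(1 / (2 * r)) * fderiv ℝ (V i) x (g x)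

/-- The approximate policy `û(x) = ∑_{j < N} ĉⱼ φⱼ(x)` in the basis functions `φⱼ`. -/
noncomputable def approxPolicy (φ : ℕ → EuclideanSpace ℝ (Fin n) → ℝ) (N : ℕ) (c : ℕ → ℝ)
    (x : EuclideanSpace ℝ (Fin n)) : ℝ :=
  ∑ j ∈ Finset.range N, c j * φ j x

/-- The robust redesign `u_ro(x) = [1 + (r/2) ρ²(|x|²)] û(x)` of a policy `û`. -/
noncomputable def robustPolicy (r : ℝ) (ρ : ℝ → ℝ) (uhat : EuclideanSpace ℝ (Fin n) → ℝ)
    (x : EuclideanSpace ℝ (Fin n)) : ℝ :=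
  (1 + r / 2 * ρ (‖x‖ ^ 2) ^ 2) * uhat x

/-- The gain `γ(s) = ½ ε ρ(s²) s`. -/
noncomputable def gain (ε : ℝ) (ρ : ℝ → ℝ) (s : ℝ) : ℝ :=
  1 / 2 * ε * ρ (s ^ 2) * s

/-- The error `e_ro = (r/2) ρ²(|x|²) [û - u_next] + û - u_cur`, where `û` approximates the policy
`u_next` that policy iteration produces from `u_cur`. -/
noncomputable def redesignError (r : ℝ) (ρ : ℝ → ℝ)
    (uhat unext ucur : EuclideanSpace ℝ (Fin n) → ℝ) (x : EuclideanSpace ℝ (Fin n)) : ℝ :=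
  r / 2 * ρ (‖x‖ ^ 2) ^ 2 * (uhat x - unext x) + uhat x - ucur x

/-- The closed-loop vector field on the states `(w, x)`, under the feedback `u = μ(x)`:
`ẇ = Δ_w(w, x)`, `ẋ = f(x) + g(x) [μ(x) + Δ(w, x)]`. -/
def closedLoop (f g : EuclideanSpace ℝ (Fin n) → EuclideanSpace ℝ (Fin n))
    (Δw : EuclideanSpace ℝ (Fin p) × EuclideanSpace ℝ (Fin n) → EuclideanSpace ℝ (Fin p))
    (Δ : EuclideanSpace ℝ (Fin p) × EuclideanSpace ℝ (Fin n) → ℝ)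
    (μ : EuclideanSpace ℝ (Fin n) → ℝ)
    (z : EuclideanSpace ℝ (Fin p) × EuclideanSpace ℝ (Fin n)) :
    EuclideanSpace ℝ (Fin p) × EuclideanSpace ℝ (Fin n) :=
  (Δw z, f z.2 + (μ z.2 + Δ z) • g z.2)

/-- The dynamic uncertainty `ẇ = Δ_w(w, x)` with output `Δ(w, x)`: `W` is a `C¹` positive definite
function with `λ₁(|w|) ≤ W(w) ≤ λ₂(|w|)`, `|Δ(w, x)| ≤ max{κ₁(|w|), κ₂(|x|)}`, and
`W(w) ≥ κ₃(|x|)` implies `∇W(w) Δ_w(w, x) ≤ -κ₄(w)`, with `λ₁, λ₂` of class `𝒦∞`,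
`κ₁, κ₂, κ₃` of class `𝒦` and `κ₄` positive definite. -/
structure IsISSUncertainty
    (Δw : EuclideanSpace ℝ (Fin p) × EuclideanSpace ℝ (Fin n) → EuclideanSpace ℝ (Fin p))
    (Δ : EuclideanSpace ℝ (Fin p) × EuclideanSpace ℝ (Fin n) → ℝ)
    (W : EuclideanSpace ℝ (Fin p) → ℝ) (lam₁ lam₂ κ₁ κ₂ κ₃ : ℝ≥0 → ℝ≥0)
    (κ₄ : EuclideanSpace ℝ (Fin p) → ℝ) : Prop where
  contDiff : ContDiff ℝ 1 W
  posDef : IsPosDefFun W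
  classKInf_lam₁ : IsClassKInf lam₁
  classKInf_lam₂ : IsClassKInf lam₂
  classK_κ₁ : IsClassK κ₁
  classK_κ₂ : IsClassK κ₂
  classK_κ₃ : IsClassK κ₃
  posDef_κ₄ : IsPosDefFun κ₄
  lower : ∀ w, (lam₁ ‖w‖₊ : ℝ) ≤ W w
  upper : ∀ w, W w ≤ (lam₂ ‖w‖₊ : ℝ)
  output_le : ∀ w x, |Δ (w, x)| ≤ max (κ₁ ‖w‖₊ : ℝ) (κ₂ ‖x‖₊ : ℝ)
  decrease : ∀ w x, (κ₃ ‖x‖₊ : ℝ) ≤ W w → fderiv ℝ W w (Δw (w, x)) ≤ -κ₄ w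

end Control

/-!
The Lyapunov function of the closed loop is `U(w, x) = max (σ (V x)) (W w)`, with `V = V_{i*}` and
a gain `σ` of class `𝒦∞` that satisfies `κ₃ ∘ α₁⁻¹ ≤ σ` and `κ₁ ∘ lam₁⁻¹ ∘ σ ≤ γ ∘ α₂⁻¹`. The gain
condition says that `κ₃ ∘ α₁⁻¹` has both properties; `exists_isClassKInf_ge_of_comp_le` enlarges it
to an unbounded function without losing the second.

Policy iteration and completing the square give, along the closed loop,
`V̇ ≤ -Q(x) + ((e_ro + Δ) / ρ)²`, which is negative as soon as `|e_ro|` and `|Δ|` are at most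
`γ(|x|)` (`IsPolicyIteration.fderiv_robustPolicy_neg`). Where `W ≤ σ(V)` the second property of `σ`
provides the bound on `Δ`; where `W ≥ σ(V)` the first one gives `W ≥ κ₃(|x|)`, hence `Ẇ < 0`
(`isMaxLyapunovPair_closedLoop`). So the function that realizes the maximum always decreases.

As `U` is not differentiable, stability is derived from the one-sided derivatives of `V` and `W`
separately. A barrier argument (`le_of_eventually_le_right`) shows that `U` does not increase along
solutions. This confines them to a compact sublevel set, on which the field is locally Lipschitz,
so they exist for all times; it also forces the origin to be an equilibrium. By compactness the
decrease is uniform on shells `L ≤ U ≤ M`, which excludes a positive limit of `U`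
(`IsMaxLyapunovPair.exists_maxLyapunov_lt`).
-/

/-! ### One-sided monotonicity of real functions -/

theorem eventually_lt_of_hasDerivWithinAt_neg {y : ℝ → ℝ} {y' t : ℝ}
    (hy : HasDerivWithinAt y y' (Ici t) t) (h : y' < 0) : ∀ᶠ s in 𝓝[>] t, y s < y t := by
  have h1 := (hasDerivWithinAt_iff_tendsto_slope' (by simp : t ∉ Ioi t)).1 hy.Ioi_of_Ici
  filter_upwards [h1.eventually_lt_const h, self_mem_nhdsWithin] with s hs hts
  rw [slope_def_field, div_lt_iff₀ (sub_pos.2 hts)] at hs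
  linarith

/-- A barrier argument: a continuous function that, wherever its value is in `(0, M]`, does not
increase immediately to the right cannot climb above its initial value. Nothing is asked where the
value is `0`: an excursion above `0` would have to cross a small positive level. -/
theorem le_of_eventually_le_right {h : ℝ → ℝ} {M a b : ℝ} (hM : 0 < M)
    (hc : ContinuousOn h (Icc a b))
    (hr : ∀ t ∈ Ico a b, 0 < h t → h t ≤ M → ∀ᶠ s in 𝓝[>] t, h s ≤ h t)
    (hab : a ≤ b) (h0 : 0 ≤ h a) (ha : h a ≤ M) : h b ≤ h a := by
  by_contra! hlt
  -- a level `c` that is attained strictly before `b`, at which `hr` applies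
  set c := max (h a) (min M (h b / 2)) with hcdef
  have hc0 : 0 < c := lt_max_of_lt_right (lt_min hM (by linarith))
  have hcM : c ≤ M := max_le ha (min_le_left _ _)
  have hcb : c < h b := max_lt hlt ((min_le_right _ _).trans_lt (by linarith))
  have key : Icc a b ⊆ {t | h t ≤ c} := by
    refine IsClosed.Icc_subset_of_forall_mem_nhdsWithin ?_ (show h a ≤ c from le_max_left _ _) ?_
    · rw [inter_comm]
      exact hc.preimage_isClosed_of_isClosed isClosed_Icc isClosed_Iic
    · rintro t ⟨htc, ht⟩
      rcases (show h t ≤ c from htc).lt_or_eq with hlt' | heq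
      · have h1 : ContinuousWithinAt h (Ioi t) t :=
          (hc t (Ico_subset_Icc_self ht)).mono_of_mem_nhdsWithin
            (mem_of_superset (Ioc_mem_nhdsGT ht.2) fun s hs => ⟨ht.1.trans hs.1.le, hs.2⟩)
        exact (h1.tendsto.eventually_lt_const hlt').mono fun s hs => le_of_lt hs
      · exact (hr t ht (heq ▸ hc0) (heq ▸ hcM)).mono fun s hs => hs.trans heq.le
  exact absurd (key (right_mem_Icc.2 hab)) (not_le.2 hcb)

/-- A function that is bounded below and decreases at rate at least `δ` whenever it is `≥ a`
falls to the level `a` in finite time, and stays below it from then on. -/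
theorem exists_forall_le_of_deriv_le_neg {y y' : ℝ → ℝ} {T a m δ : ℝ} (hδ : 0 < δ)
    (hy : ∀ t, T ≤ t → HasDerivWithinAt y (y' t) (Ici T) t)
    (hm : ∀ t, T ≤ t → m ≤ y t) (hd : ∀ t, T ≤ t → a ≤ y t → y' t ≤ -δ) :
    ∃ T', T ≤ T' ∧ ∀ t, T' ≤ t → y t ≤ a := by
  have hcont : ContinuousOn y (Ici T) := fun t ht => (hy t ht).continuousWithinAt
  have hder : ∀ t, T ≤ t → HasDerivWithinAt y (y' t) (Ici t) t := fun t ht =>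
    (hy t ht).mono (Ici_subset_Ici.2 ht)
  obtain ⟨T', hT', hyT'⟩ : ∃ T', T ≤ T' ∧ y T' ≤ a := by
    by_contra! hall
    have hb : T ≤ T + ((y T - m) / δ + 1) := by
      have : 0 ≤ (y T - m) / δ := div_nonneg (sub_nonneg.2 (hm T le_rfl)) hδ.le
      linarith
    have := image_le_of_deriv_right_le_deriv_boundary (f := y) (f' := y')
      (B := fun t => y T - δ * (t - T)) (B' := fun _ => -δ)
      (hcont.mono Icc_subset_Ici_self) (fun t ht => hder t ht.1) (by simp) (by fun_prop)
      (fun t _ => by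
        have := (((hasDerivAt_id t).sub_const T).const_mul δ).const_sub (y T)
        simpa using this.hasDerivWithinAt)
      (fun t ht => hd t ht.1 (hall t ht.1).le) (right_mem_Icc.2 hb)
    have h2 := hm _ hb
    have h3 : δ * ((y T - m) / δ) = y T - m := by field_simp
    simp only [add_sub_cancel_left] at this
    nlinarith
  refine ⟨T', hT', fun t ht => ?_⟩
  exact image_le_of_deriv_right_lt_deriv_boundary' (f := y) (f' := y') (B := fun _ => a)
    (B' := fun _ => 0) (hcont.mono fun s hs => hT'.trans hs.1)
    (fun s hs => hder s (hT'.trans hs.1)) hyT' continuousOn_const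
    (fun s _ => hasDerivWithinAt_const _ _ _)
    (fun s hs he => (hd s (hT'.trans hs.1) he.ge).trans_lt (neg_lt_zero.2 hδ))
    (right_mem_Icc.2 ht)

/-! ### Solutions on `[0, ∞)` -/

/-- A bounded, globally Lipschitz vector field is complete. Since the field is bounded,
Picard–Lindelöf applies on every interval `[-(k + 1), k + 1]` at once; the solutions agree by
uniqueness and are glued along `t ↦ ⌊t⌋₊`. -/
theorem exists_isSolution_of_lipschitzWith_of_bounded {E : Type*} [NormedAddCommGroup E]
    [NormedSpace ℝ E] [CompleteSpace E] {G : E → E} {K L : ℝ≥0} (hG : LipschitzWith K G)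
    (hL : ∀ z, ‖G z‖ ≤ L) (z₀ : E) : ∃ z, IsSolution G z₀ z := by
  have hloc : ∀ k : ℕ, ∃ α : ℝ → E, α 0 = z₀ ∧
      ∀ t ∈ Icc (-(k + 1 : ℝ)) (k + 1),
        HasDerivWithinAt α (G (α t)) (Icc (-(k + 1 : ℝ)) (k + 1)) t := by
    intro k
    have h0 : (0 : ℝ) ∈ Icc (-(k + 1 : ℝ)) (k + 1) :=
      ⟨by linarith [k.cast_nonneg (α := ℝ)], by positivity⟩
    have hpl : IsPicardLindelof (fun _ => G) (⟨0, h0⟩ : Icc (-(k + 1 : ℝ)) (k + 1)) z₀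
        (L * (k + 1)) 0 L K :=
      { lipschitzOnWith := fun _ _ => hG.lipschitzOnWith
        continuousOn := fun _ _ => continuousOn_const
        norm_le := fun _ _ x _ => hL x
        mul_max_le := by simp }
    exact hpl.exists_eq_forall_mem_Icc_hasDerivWithinAt₀
  choose α hα0 hα using hloc
  have hαI : ∀ k : ℕ, ∀ t : ℝ, 0 ≤ t → t < k + 1 → HasDerivAt (α k) (G (α k t)) t :=
    fun k t h0 h1 => (hα k t ⟨by linarith, h1.le⟩).hasDerivAt (Icc_mem_nhds (by linarith) h1)
  have huniq : ∀ j k : ℕ, j ≤ k → ∀ t : ℝ, 0 ≤ t → t < j + 1 → α j t = α k t := by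
    intro j k hjk t h0 h1
    have hjk' : (j : ℝ) ≤ k := by exact_mod_cast hjk
    exact ODE_solution_unique (v := fun _ => G) (K := K) (a := 0) (b := t) (fun _ => hG)
      (fun s hs => (hαI j s hs.1 (hs.2.trans_lt h1)).continuousAt.continuousWithinAt)
      (fun s hs => (hαI j s hs.1 (hs.2.trans h1)).hasDerivWithinAt)
      (fun s hs => (hαI k s hs.1 (by linarith [hs.2])).continuousAt.continuousWithinAt)
      (fun s hs => (hαI k s hs.1 (by linarith [hs.2])).hasDerivWithinAt)
      (by rw [hα0, hα0]) (right_mem_Icc.2 h0)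
  refine ⟨fun t => α ⌊t⌋₊ t, by simp [hα0], fun t ht => ?_⟩
  refine (hαI ⌊t⌋₊ t ht (Nat.lt_floor_add_one t)).hasDerivWithinAt.congr_of_eventuallyEq ?_ rfl
  filter_upwards [self_mem_nhdsWithin, nhdsWithin_le_nhds (Iio_mem_nhds (Nat.lt_floor_add_one t))]
    with s hs0 hs1
  refine huniq _ _ ?_ s hs0 (Nat.lt_floor_add_one s)
  have : ⌊s⌋₊ < ⌊t⌋₊ + 1 := (Nat.floor_lt hs0).2 (by exact_mod_cast hs1)
  omega

/-- A field that is locally Lipschitz on a compact set agrees there with a bounded, globally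
Lipschitz field: the Lipschitz extension is truncated coordinatewise. -/
theorem exists_lipschitzWith_bounded_eqOn {E : Type*} [NormedAddCommGroup E] [NormedSpace ℝ E]
    [FiniteDimensional ℝ E] {F : E → E} {S : Set E} (hS : IsCompact S)
    (hF : LocallyLipschitzOn S F) :
    ∃ (G : E → E) (K L : ℝ≥0), LipschitzWith K G ∧ (∀ z, ‖G z‖ ≤ L) ∧ EqOn F G S := by
  obtain ⟨K, hK⟩ := hF.exists_lipschitzOnWith_of_compact hS
  obtain ⟨m, ⟨e⟩⟩ : ∃ m : ℕ, Nonempty (E ≃L[ℝ] (Fin m → ℝ)) :=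
    ⟨Module.finrank ℝ E, ⟨ContinuousLinearEquiv.ofFinrankEq (by simp)⟩⟩
  obtain ⟨g, hg, hgF⟩ := (e.lipschitz.comp_lipschitzOnWith hK).extend_pi
  obtain ⟨C, hC⟩ := (hS.image_of_continuousOn (hF.continuousOn)).isBounded.exists_norm_le
  set C' : ℝ := ‖(e : E →L[ℝ] (Fin m → ℝ))‖ * C
  -- truncation of each coordinate to `[-C', C']`
  let cl : (Fin m → ℝ) → (Fin m → ℝ) := fun v i => max (-C') (min C' (v i))
  have hcl : LipschitzWith 1 cl := by
    refine LipschitzWith.of_dist_le_mul fun v v' => ?_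
    refine (dist_pi_le_iff (by positivity)).2 fun i => ?_
    have h1 := (((LipschitzWith.id (α := ℝ)).const_min C').const_max (-C')).dist_le_mul (v i) (v' i)
    refine h1.trans ?_
    gcongr
    exact dist_le_pi_dist v v' i
  have hclb : ∀ v, ‖cl v‖ ≤ |C'| := fun v => by
    refine (pi_norm_le_iff_of_nonneg (abs_nonneg _)).2 fun i => ?_
    simp only [cl, Real.norm_eq_abs]
    grind
  refine ⟨fun z => e.symm (cl (g z)), _,
    ‖(e.symm : (Fin m → ℝ) →L[ℝ] E)‖₊ * ⟨|C'|, abs_nonneg _⟩,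
    e.symm.lipschitz.comp (hcl.comp hg), fun z => ?_, fun z hz => ?_⟩
  · refine ((e.symm : (Fin m → ℝ) →L[ℝ] E).le_opNorm _).trans ?_
    exact mul_le_mul_of_nonneg_left (hclb _) (norm_nonneg _)
  · have h1 : g z = e (F z) := (hgF hz).symm
    have h2 : cl (e (F z)) = e (F z) := by
      funext i
      have h3 : |e (F z) i| ≤ C' := by
        rw [← Real.norm_eq_abs]
        refine (norm_le_pi_norm _ i).trans (((e : E →L[ℝ] (Fin m → ℝ)).le_opNorm _).trans ?_)
        exact mul_le_mul_of_nonneg_left (hC _ (mem_image_of_mem _ hz)) (norm_nonneg _)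
      rw [abs_le] at h3
      simp only [cl]
      rw [min_eq_right h3.2, max_eq_right h3.1]
    simp only [h1, h2, ContinuousLinearEquiv.symm_apply_apply]

theorem IsSolution.continuousOn {E : Type*} [NormedAddCommGroup E] [NormedSpace ℝ E]
    {F : E → E} {z₀ : E} {z : ℝ → E} (hz : IsSolution F z₀ z) : ContinuousOn z (Ici 0) :=
  fun t ht => (hz.2 t ht).continuousWithinAt

theorem IsSolution.hasDerivWithinAt_comp {E : Type*} [NormedAddCommGroup E] [NormedSpace ℝ E]
    {F : E → E} {z₀ : E} {z : ℝ → E} {φ : E → ℝ} (hz : IsSolution F z₀ z) (hφ : ContDiff ℝ 1 φ)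
    {t : ℝ} (ht : 0 ≤ t) :
    HasDerivWithinAt (fun s => φ (z s)) (fderiv ℝ φ (z t) (F (z t))) (Ici 0) t :=
  (hφ.differentiable one_ne_zero (z t)).hasFDerivAt.comp_hasDerivWithinAt t (hz.2 t ht)

theorem exists_pos_forall_le_of_isCompact {E : Type*} [TopologicalSpace E] {K : Set E}
    (hK : IsCompact K) {ψ : E → ℝ}
    (hψ : ContinuousOn ψ K) (hpos : ∀ z ∈ K, 0 < ψ z) : ∃ δ, 0 < δ ∧ ∀ z ∈ K, δ ≤ ψ z := by
  rcases K.eq_empty_or_nonempty with rfl | hne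
  · exact ⟨1, one_pos, fun z hz => hz.elim⟩
  · obtain ⟨z₀, hz₀, hmin⟩ := hK.exists_isMinOn hne hψ
    exact ⟨ψ z₀, hpos _ hz₀, fun z hz => hmin hz⟩

/-! ### Asymptotic stability from a maximum of two functions -/

/-- The Lyapunov function `max (σ ∘ B) A`. The gain `σ` acts on `ℝ≥0`, so `B` is truncated at `0`;
it is only used for `B ≥ 0`. -/
noncomputable def maxLyapunov {E : Type*} (σ : ℝ≥0 → ℝ≥0) (A B : E → ℝ) (z : E) : ℝ :=
  max (σ (B z).toNNReal : ℝ) (A z)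

/-- The small-gain conditions on `A`, `B` and the gain `σ` for the field `F`, on the compact
sublevel set `{max (σ ∘ B) A ≤ M}`: away from the origin, `A` decreases strictly along `F` where it
realizes the maximum, and `B` decreases strictly where `σ ∘ B` does. Only `A` and `B` are `C¹`;
`σ` need not be differentiable. -/
structure IsMaxLyapunovPair {E : Type*} [NormedAddCommGroup E] [NormedSpace ℝ E]
    (F : E → E) (σ : ℝ≥0 → ℝ≥0) (A B : E → ℝ) (M : ℝ) : Prop where
  classKInf : IsClassKInf σ
  level_pos : 0 < M
  contDiff_left : ContDiff ℝ 1 A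
  contDiff_right : ContDiff ℝ 1 B
  nonneg_left : ∀ z, 0 ≤ A z
  nonneg_right : ∀ z, 0 ≤ B z
  zero_left : A 0 = 0
  zero_right : B 0 = 0
  eq_zero : ∀ z, A z = 0 → B z = 0 → z = 0
  isCompact : IsCompact {z | maxLyapunov σ A B z ≤ M}
  locallyLipschitzOn : LocallyLipschitzOn {z | maxLyapunov σ A B z ≤ M} F
  deriv_left : ∀ z ≠ 0, maxLyapunov σ A B z ≤ M → (σ (B z).toNNReal : ℝ) ≤ A z →
    fderiv ℝ A z (F z) < 0
  deriv_right : ∀ z ≠ 0, maxLyapunov σ A B z ≤ M → A z ≤ (σ (B z).toNNReal : ℝ) →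
    fderiv ℝ B z (F z) < 0

namespace IsMaxLyapunovPair

variable {E : Type*} [NormedAddCommGroup E] [NormedSpace ℝ E] {F G : E → E} {σ : ℝ≥0 → ℝ≥0}
  {A B : E → ℝ} {M : ℝ}

theorem congr (h : IsMaxLyapunovPair F σ A B M)
    (hFG : EqOn F G {z | maxLyapunov σ A B z ≤ M}) : IsMaxLyapunovPair G σ A B M where
  __ := h
  locallyLipschitzOn := fun x hx => by
    obtain ⟨K, t, ht, hK⟩ := h.locallyLipschitzOn hx
    refine ⟨K, t ∩ {z | maxLyapunov σ A B z ≤ M}, inter_mem ht self_mem_nhdsWithin, ?_⟩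
    intro y hy z hz
    rw [← hFG hy.2, ← hFG hz.2]
    exact hK hy.1 hz.1
  deriv_left := fun z hz hM => by rw [← hFG hM]; exact h.deriv_left z hz hM
  deriv_right := fun z hz hM => by rw [← hFG hM]; exact h.deriv_right z hz hM

variable (h : IsMaxLyapunovPair F σ A B M)
include h

theorem continuous_gain : Continuous fun z => (σ (B z).toNNReal : ℝ) :=
  NNReal.continuous_coe.comp (h.classKInf.continuous.comp
    (continuous_real_toNNReal.comp h.contDiff_right.continuous))

theorem continuous : Continuous (maxLyapunov σ A B) :=
  h.continuous_gain.max h.contDiff_left.continuous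

theorem nonneg (z : E) : 0 ≤ maxLyapunov σ A B z := (h.nonneg_left z).trans (le_max_right _ _)

theorem map_zero : maxLyapunov σ A B 0 = 0 := by
  simp [maxLyapunov, h.zero_left, h.zero_right, h.classKInf.map_zero]

theorem eq_zero_of_nonpos {z : E} (hz : maxLyapunov σ A B z ≤ 0) : z = 0 := by
  have hA := (le_max_right _ _).trans hz
  have hB : (σ (B z).toNNReal : ℝ) ≤ 0 := (le_max_left _ _).trans hz
  refine h.eq_zero z (hA.antisymm (h.nonneg_left z)) ((h.nonneg_right z).antisymm' ?_)
  rw [← Real.toNNReal_eq_zero]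
  apply h.classKInf.strictMono.injective
  rw [h.classKInf.map_zero]
  exact le_antisymm (by exact_mod_cast hB) zero_le

theorem pos {z : E} (hz : z ≠ 0) : 0 < maxLyapunov σ A B z := by
  by_contra! hle
  exact hz (h.eq_zero_of_nonpos hle)

/-- Small sublevel sets of the Lyapunov function are small neighbourhoods of the origin. -/
theorem exists_sublevel_subset_ball {η : ℝ} (hη : 0 < η) :
    ∃ m, 0 < m ∧ m ≤ M ∧ ∀ z, maxLyapunov σ A B z < m → ‖z‖ < η := by
  have hK : IsCompact ({z | maxLyapunov σ A B z ≤ M} ∩ {z | η ≤ ‖z‖}) :=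
    h.isCompact.inter_right (isClosed_le continuous_const continuous_norm)
  rcases Set.eq_empty_or_nonempty ({z | maxLyapunov σ A B z ≤ M} ∩ {z | η ≤ ‖z‖}) with he | hne
  · refine ⟨M, h.level_pos, le_rfl, fun z hz => ?_⟩
    by_contra! hle
    exact eq_empty_iff_forall_notMem.1 he z ⟨hz.le, hle⟩
  · obtain ⟨z₀, hz₀, hmin⟩ := hK.exists_isMinOn hne h.continuous.continuousOn
    refine ⟨maxLyapunov σ A B z₀, h.pos ?_, hz₀.1, fun z hz => ?_⟩
    · rintro rfl
      exact absurd hz₀.2 (by simpa using hη)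
    · by_contra! hle
      exact absurd (hmin ⟨hz.le.trans hz₀.1, hle⟩) (not_le.2 hz)

variable {z : ℝ → E} {z₀ : E}

/-- Whichever of `A` and `σ ∘ B` realizes the maximum decreases strictly, and the other one, being
strictly smaller, stays below the maximum for a while by continuity. -/
theorem eventually_le_right (hz : IsSolution F z₀ z) {t : ℝ} (ht : 0 ≤ t)
    (h0 : 0 < maxLyapunov σ A B (z t)) (hM : maxLyapunov σ A B (z t) ≤ M) :
    ∀ᶠ s in 𝓝[>] t, maxLyapunov σ A B (z s) ≤ maxLyapunov σ A B (z t) := by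
  have hne : z t ≠ 0 := fun he => by rw [he, h.map_zero] at h0; exact lt_irrefl _ h0
  have hzc : Tendsto z (𝓝[>] t) (𝓝 (z t)) :=
    (hz.2 t ht).continuousWithinAt.mono (Ioi_subset_Ici ht)
  have hsub : Ici t ⊆ Ici 0 := Ici_subset_Ici.2 ht
  have hA : ∀ᶠ s in 𝓝[>] t, A (z s) ≤ maxLyapunov σ A B (z t) := by
    rcases le_or_gt (σ (B (z t)).toNNReal : ℝ) (A (z t)) with hle | hlt
    · refine (eventually_lt_of_hasDerivWithinAt_neg
        ((hz.hasDerivWithinAt_comp h.contDiff_left ht).mono hsub)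
        (h.deriv_left _ hne hM hle)).mono fun s hs => ?_
      exact hs.le.trans (le_max_right _ _)
    · refine (((h.contDiff_left.continuous.tendsto _).comp hzc).eventually_lt_const hlt).mono
        fun s hs => ?_
      exact hs.le.trans (le_max_left _ _)
  have hB : ∀ᶠ s in 𝓝[>] t, (σ (B (z s)).toNNReal : ℝ) ≤ maxLyapunov σ A B (z t) := by
    rcases le_or_gt (A (z t)) (σ (B (z t)).toNNReal : ℝ) with hle | hlt
    · refine (eventually_lt_of_hasDerivWithinAt_neg
        ((hz.hasDerivWithinAt_comp h.contDiff_right ht).mono hsub)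
        (h.deriv_right _ hne hM hle)).mono fun s hs => ?_
      refine le_trans ?_ (le_max_left _ _)
      exact_mod_cast h.classKInf.strictMono.monotone (Real.toNNReal_le_toNNReal hs.le)
    · refine (((h.continuous_gain.tendsto _).comp hzc).eventually_lt_const hlt).mono
        fun s hs => ?_
      exact hs.le.trans (le_max_right _ _)
  filter_upwards [hA, hB] with s hsA hsB using max_le hsB hsA

theorem maxLyapunov_le (hz : IsSolution F z₀ z) (hz₀ : maxLyapunov σ A B z₀ ≤ M) {s t : ℝ}
    (hs : 0 ≤ s) (hst : s ≤ t) : maxLyapunov σ A B (z t) ≤ maxLyapunov σ A B (z s) := by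
  have aux : ∀ {s t : ℝ}, 0 ≤ s → s ≤ t → maxLyapunov σ A B (z s) ≤ M →
      maxLyapunov σ A B (z t) ≤ maxLyapunov σ A B (z s) := fun {s t} hs hst hM =>
    le_of_eventually_le_right (h := fun t => maxLyapunov σ A B (z t)) h.level_pos
      (h.continuous.comp_continuousOn (hz.continuousOn.mono fun τ hτ => hs.trans hτ.1))
      (fun τ hτ h0 h1 => h.eventually_le_right hz (hs.trans hτ.1) h0 h1) hst (h.nonneg _) hM
  have h0 : maxLyapunov σ A B (z 0) ≤ M := by rwa [hz.1]
  exact aux hs hst ((aux le_rfl hs h0).trans h0)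

theorem maxLyapunov_le_initial (hz : IsSolution F z₀ z) (hz₀ : maxLyapunov σ A B z₀ ≤ M) {t : ℝ}
    (ht : 0 ≤ t) : maxLyapunov σ A B (z t) ≤ maxLyapunov σ A B z₀ := by
  simpa [hz.1] using h.maxLyapunov_le hz hz₀ le_rfl ht

/-- Since solutions cannot leave the sublevel set, the field may be replaced outside of it by a
complete one. -/
theorem exists_isSolution [FiniteDimensional ℝ E] (hz₀ : maxLyapunov σ A B z₀ ≤ M) :
    ∃ z, IsSolution F z₀ z := by
  obtain ⟨G, K, L, hG, hL, hFG⟩ :=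
    exists_lipschitzWith_bounded_eqOn h.isCompact h.locallyLipschitzOn
  obtain ⟨z, hz⟩ := exists_isSolution_of_lipschitzWith_of_bounded hG hL z₀
  refine ⟨z, hz.1, fun t ht => ?_⟩
  rw [hFG (show maxLyapunov σ A B (z t) ≤ M from
    ((h.congr hFG).maxLyapunov_le_initial hz hz₀ ht).trans hz₀)]
  exact hz.2 t ht

/-- The origin is an equilibrium, because the solution that starts there cannot leave it. -/
theorem map_origin [FiniteDimensional ℝ E] : F 0 = 0 := by
  have h0 : maxLyapunov σ A B (0 : E) ≤ M := h.map_zero.le.trans h.level_pos.le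
  obtain ⟨z, hz⟩ := h.exists_isSolution h0
  have hz0 : ∀ t ∈ Ici (0 : ℝ), z t = 0 := fun t ht =>
    h.eq_zero_of_nonpos ((h.maxLyapunov_le_initial hz h0 ht).trans h.map_zero.le)
  have h1 : HasDerivWithinAt z (F 0) (Ici 0) 0 := by
    simpa [hz0 0 self_mem_Ici] using hz.2 0 self_mem_Ici
  have h2 : HasDerivWithinAt z 0 (Ici 0) 0 :=
    (hasDerivWithinAt_const (0 : ℝ) (Ici 0) (0 : E)).congr hz0 (hz0 0 self_mem_Ici)
  exact (uniqueDiffOn_Ici (0 : ℝ) 0 self_mem_Ici).eq_deriv _ h1 h2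

theorem isLyapunovStable [FiniteDimensional ℝ E] : IsLyapunovStable F := by
  intro η hη
  obtain ⟨m, hm, hmM, hball⟩ := h.exists_sublevel_subset_ball hη
  have hnear : {z | maxLyapunov σ A B z < m} ∈ 𝓝 (0 : E) :=
    (isOpen_lt h.continuous continuous_const).mem_nhds (by simpa [h.map_zero] using hm)
  obtain ⟨δ, hδ, hδm⟩ := Metric.mem_nhds_iff.1 hnear
  refine ⟨δ, hδ, fun z₀ hz₀ => ?_⟩
  have hz₀m : maxLyapunov σ A B z₀ < m := hδm (by simpa using hz₀)
  have hz₀M := hz₀m.le.trans hmM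
  exact ⟨h.exists_isSolution hz₀M, fun z hz t ht =>
    hball _ ((h.maxLyapunov_le_initial hz hz₀M ht).trans_lt hz₀m)⟩

theorem continuousOn_fderiv_apply {φ : E → ℝ} (hφ : ContDiff ℝ 1 φ) :
    ContinuousOn (fun z => fderiv ℝ φ z (F z)) {z | maxLyapunov σ A B z ≤ M} :=
  (hφ.continuous_fderiv one_ne_zero).continuousOn.clm_apply h.locallyLipschitzOn.continuousOn

/-- On the compact shell `{L ≤ max (σ ∘ B) A ≤ M}` the decrease is uniform: `A` decreases at rate
`δ` unless it is below `σ ∘ B` by at least `δ`, and likewise for `B`. -/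
theorem exists_uniform_decrease {L : ℝ} (hL : 0 < L) : ∃ δ, 0 < δ ∧ ∀ z,
    L ≤ maxLyapunov σ A B z → maxLyapunov σ A B z ≤ M →
      (δ ≤ (σ (B z).toNNReal : ℝ) - A z ∨ fderiv ℝ A z (F z) ≤ -δ) ∧
      (δ ≤ A z - (σ (B z).toNNReal : ℝ) ∨ fderiv ℝ B z (F z) ≤ -δ) := by
  have hK : IsCompact ({z | maxLyapunov σ A B z ≤ M} ∩ {z | L ≤ maxLyapunov σ A B z}) :=
    h.isCompact.inter_right (isClosed_le continuous_const h.continuous)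
  have hne : ∀ z, L ≤ maxLyapunov σ A B z → z ≠ 0 := by
    rintro z hz rfl
    rw [h.map_zero] at hz
    exact absurd hz (not_le.2 hL)
  have hg := h.continuous_gain.continuousOn
    (s := {z | maxLyapunov σ A B z ≤ M} ∩ {z | L ≤ maxLyapunov σ A B z})
  have hAc := h.contDiff_left.continuous.continuousOn
    (s := {z | maxLyapunov σ A B z ≤ M} ∩ {z | L ≤ maxLyapunov σ A B z})
  obtain ⟨δ₁, hδ₁, h₁⟩ := exists_pos_forall_le_of_isCompact hK
    (ψ := fun z => max ((σ (B z).toNNReal : ℝ) - A z) (-fderiv ℝ A z (F z)))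
    ((hg.sub hAc).sup
      ((h.continuousOn_fderiv_apply h.contDiff_left).mono inter_subset_left).neg)
    (fun z hz => by
      rcases lt_or_ge (A z) (σ (B z).toNNReal : ℝ) with hlt | hle
      · exact lt_max_of_lt_left (sub_pos.2 hlt)
      · exact lt_max_of_lt_right (neg_pos.2 (h.deriv_left z (hne z hz.2) hz.1 hle)))
  obtain ⟨δ₂, hδ₂, h₂⟩ := exists_pos_forall_le_of_isCompact hK
    (ψ := fun z => max (A z - (σ (B z).toNNReal : ℝ)) (-fderiv ℝ B z (F z)))
    ((hAc.sub hg).sup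
      ((h.continuousOn_fderiv_apply h.contDiff_right).mono inter_subset_left).neg)
    (fun z hz => by
      rcases lt_or_ge (σ (B z).toNNReal : ℝ) (A z) with hlt | hle
      · exact lt_max_of_lt_left (sub_pos.2 hlt)
      · exact lt_max_of_lt_right (neg_pos.2 (h.deriv_right z (hne z hz.2) hz.1 hle)))
  refine ⟨min δ₁ δ₂, lt_min hδ₁ hδ₂, fun z hzL hzM => ⟨?_, ?_⟩⟩
  · refine (le_max_iff.1 (h₁ z ⟨hzM, hzL⟩)).imp (min_le_left _ _).trans fun hle => ?_
    linarith [min_le_left δ₁ δ₂]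
  · refine (le_max_iff.1 (h₂ z ⟨hzM, hzL⟩)).imp (min_le_right _ _).trans fun hle => ?_
    linarith [min_le_right δ₁ δ₂]

/-- The Lyapunov function becomes arbitrarily small along a solution. If it had a positive infimum
`L`, then eventually both `A` and `σ ∘ B` would be below `L + δ / 2`, so each of them would decrease
uniformly while it is `≥ L - δ / 2`; after a finite time both would be `≤ L - δ / 2`. -/
theorem exists_maxLyapunov_lt (hz : IsSolution F z₀ z) (hz₀ : maxLyapunov σ A B z₀ ≤ M) {ε : ℝ}
    (hε : 0 < ε) : ∃ T, 0 ≤ T ∧ maxLyapunov σ A B (z T) < ε := by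
  by_contra! hge
  set U : ℝ → ℝ := fun t => maxLyapunov σ A B (z t) with hU
  -- the infimum of `U` along the solution, which is its limit
  set L := sInf (U '' Ici 0) with hLdef
  have hbdd : BddBelow (U '' Ici 0) := ⟨ε, by rintro _ ⟨t, ht, rfl⟩; exact hge t ht⟩
  have hne : (U '' Ici 0).Nonempty := ⟨_, mem_image_of_mem _ self_mem_Ici⟩
  have hL : 0 < L := hε.trans_le (le_csInf hne (by rintro _ ⟨t, ht, rfl⟩; exact hge t ht))
  have hLU : ∀ t, 0 ≤ t → L ≤ U t := fun t ht => csInf_le hbdd (mem_image_of_mem _ ht)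
  have hUM : ∀ t, 0 ≤ t → U t ≤ M := fun t ht => (h.maxLyapunov_le_initial hz hz₀ ht).trans hz₀
  obtain ⟨δ₀, hδ₀, hdec₀⟩ := h.exists_uniform_decrease hL
  obtain ⟨δ, hδ, hδL, hdec⟩ : ∃ δ, 0 < δ ∧ δ ≤ L ∧ ∀ z,
      L ≤ maxLyapunov σ A B z → maxLyapunov σ A B z ≤ M →
      (δ ≤ (σ (B z).toNNReal : ℝ) - A z ∨ fderiv ℝ A z (F z) ≤ -δ) ∧
      (δ ≤ A z - (σ (B z).toNNReal : ℝ) ∨ fderiv ℝ B z (F z) ≤ -δ) := by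
    refine ⟨min δ₀ L, lt_min hδ₀ hL, min_le_right _ _, fun z h1 h2 => ?_⟩
    have hle := min_le_left δ₀ L
    refine (hdec₀ z h1 h2).imp (Or.imp hle.trans fun h3 => ?_) (Or.imp hle.trans fun h3 => ?_) <;>
      linarith
  obtain ⟨_, ⟨T, hT, rfl⟩, hTL⟩ := exists_lt_of_csInf_lt hne (show L < L + δ / 2 by linarith)
  have hT : 0 ≤ T := hT
  have hUT : ∀ t, T ≤ t → U t < L + δ / 2 := fun t ht =>
    (h.maxLyapunov_le hz hz₀ hT ht).trans_lt hTL
  have hAU : ∀ t, A (z t) ≤ U t := fun t => le_max_right _ _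
  have hBU : ∀ t, (σ (B (z t)).toNNReal : ℝ) ≤ U t := fun t => le_max_left _ _
  -- the level of `B` at which `σ ∘ B` equals `L - δ / 2`
  obtain ⟨b, hb⟩ := h.classKInf.bijective.surjective (L - δ / 2).toNNReal
  have hb' : (σ b : ℝ) = L - δ / 2 := by rw [hb, Real.coe_toNNReal _ (by linarith)]
  have hσb : ∀ t, (b : ℝ) ≤ B (z t) → L - δ / 2 ≤ σ (B (z t)).toNNReal := fun t hle => by
    rw [← hb']
    exact_mod_cast h.classKInf.strictMono.monotone (NNReal.le_toNNReal_of_coe_le hle)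
  obtain ⟨T₁, hT₁, hA⟩ := exists_forall_le_of_deriv_le_neg (y := fun t => A (z t)) (T := T)
    (a := L - δ / 2) hδ
    (fun t ht => (hz.hasDerivWithinAt_comp h.contDiff_left (hT.trans ht)).mono
      (Ici_subset_Ici.2 hT)) (fun t _ => h.nonneg_left _)
    (fun t ht hle => by
      refine (hdec (z t) (hLU t (hT.trans ht)) (hUM t (hT.trans ht))).1.resolve_left fun hcon => ?_
      linarith [hUT t ht, hBU t])
  obtain ⟨T₂, hT₂, hB⟩ := exists_forall_le_of_deriv_le_neg (y := fun t => B (z t)) (T := T)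
    (a := b) hδ
    (fun t ht => (hz.hasDerivWithinAt_comp h.contDiff_right (hT.trans ht)).mono
      (Ici_subset_Ici.2 hT)) (fun t _ => h.nonneg_right _)
    (fun t ht hle => by
      refine (hdec (z t) (hLU t (hT.trans ht)) (hUM t (hT.trans ht))).2.resolve_left fun hcon => ?_
      linarith [hUT t ht, hAU t, hσb t hle])
  have h1 := hA _ (le_max_left T₁ T₂)
  have h2 := hB _ (le_max_right T₁ T₂)
  have h3 : (σ (B (z (max T₁ T₂))).toNNReal : ℝ) ≤ L - δ / 2 := by
    rw [← hb']
    exact_mod_cast h.classKInf.strictMono.monotone (Real.toNNReal_le_iff_le_coe.2 h2)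
  have h4 := (hLU _ (hT.trans (hT₁.trans (le_max_left T₁ T₂)))).trans (max_le h3 h1)
  linarith

theorem subset_regionOfAttraction [FiniteDimensional ℝ E] :
    {z | maxLyapunov σ A B z ≤ M} ⊆ regionOfAttraction F := by
  refine fun z₀ hz₀ => ⟨h.exists_isSolution hz₀, fun z hz => ?_⟩
  rw [Metric.tendsto_atTop]
  intro η hη
  obtain ⟨m, hm, -, hball⟩ := h.exists_sublevel_subset_ball hη
  obtain ⟨T, hT, hTm⟩ := h.exists_maxLyapunov_lt hz hz₀ hm
  refine ⟨T, fun t ht => ?_⟩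
  rw [dist_zero_right]
  exact hball _ ((h.maxLyapunov_le hz hz₀ hT ht).trans_lt hTm)

theorem isAsymptoticallyStable [FiniteDimensional ℝ E] : IsAsymptoticallyStable F := by
  refine ⟨h.map_origin, h.isLyapunovStable, mem_of_superset ?_ h.subset_regionOfAttraction⟩
  refine mem_of_superset ((isOpen_lt h.continuous continuous_const).mem_nhds ?_)
    fun z (hz : maxLyapunov σ A B z < M) => hz.le
  simpa [h.map_zero] using h.level_pos

end IsMaxLyapunovPair

/-! ### Comparison functions -/

theorem IsClassKInf.leftInverse_invFun {γ : ℝ≥0 → ℝ≥0} (h : IsClassKInf γ) (s : ℝ≥0) :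
    Function.invFun γ (γ s) = s :=
  Function.leftInverse_invFun h.bijective.injective s

theorem IsClassKInf.rightInverse_invFun {γ : ℝ≥0 → ℝ≥0} (h : IsClassKInf γ) (s : ℝ≥0) :
    γ (Function.invFun γ s) = s :=
  Function.rightInverse_invFun h.bijective.surjective s

theorem IsClassKInf.invFun {γ : ℝ≥0 → ℝ≥0} (h : IsClassKInf γ) :
    IsClassKInf (Function.invFun γ) := by
  let e : ℝ≥0 ≃o ℝ≥0 := h.strictMono.orderIsoOfSurjective γ h.bijective.surjective
  have he : Function.invFun γ = e.symm := by
    funext s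
    apply h.strictMono.injective
    rw [h.rightInverse_invFun]
    exact (e.apply_symm_apply s).symm
  rw [he]
  exact ⟨⟨e.symm.continuous, e.symm.strictMono, by simpa using e.symm.map_bot⟩,
    e.symm.tendsto_atTop⟩

theorem IsClassK.comp {γ γ' : ℝ≥0 → ℝ≥0} (h : IsClassK γ) (h' : IsClassK γ') :
    IsClassK (γ ∘ γ') :=
  ⟨h.continuous.comp h'.continuous, h.strictMono.comp h'.strictMono, by
    simp [h.map_zero, h'.map_zero]⟩

theorem IsClassKInf.comp {γ γ' : ℝ≥0 → ℝ≥0} (h : IsClassKInf γ) (h' : IsClassKInf γ') :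
    IsClassKInf (γ ∘ γ') :=
  ⟨h.toIsClassK.comp h'.toIsClassK, h.tendsto_atTop.comp h'.tendsto_atTop⟩

/-- The gain of the Lyapunov function. The function `h` itself satisfies the two inequalities but
may be bounded, so it is replaced by its maximum with `k̂⁻¹ ∘ Γ`, where `k̂ y = k y + y` is of class
`𝒦∞` and dominates `k`. -/
theorem exists_isClassKInf_ge_of_comp_le {h k Γ : ℝ≥0 → ℝ≥0} (hh : IsClassK h) (hk : IsClassK k)
    (hΓ : IsClassKInf Γ) (hle : ∀ s, k (h s) ≤ Γ s) :
    ∃ σ, IsClassKInf σ ∧ (∀ s, h s ≤ σ s) ∧ ∀ s, k (σ s) ≤ Γ s := by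
  have hk' : IsClassKInf fun y => k y + y :=
    ⟨⟨hk.continuous.add continuous_id, hk.strictMono.add strictMono_id, by simp [hk.map_zero]⟩,
      tendsto_atTop_mono (fun y => le_add_self) tendsto_id⟩
  have hτ := hk'.invFun.comp hΓ
  set τ := Function.invFun (fun y => k y + y) ∘ Γ with hτdef
  have hkτ : ∀ s, k (τ s) ≤ Γ s := fun s =>
    le_self_add.trans (hk'.rightInverse_invFun (Γ s)).le
  refine ⟨fun s => max (h s) (τ s), ⟨⟨hh.continuous.max hτ.continuous,
    fun a b hab => max_lt_max (hh.strictMono hab) (hτ.strictMono hab), ?_⟩,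
    tendsto_atTop_mono (fun s => le_max_right _ _) hτ.tendsto_atTop⟩,
    fun s => le_max_left _ _, fun s => ?_⟩
  · simp [hh.map_zero, hτ.map_zero]
  · rw [hk.strictMono.monotone.map_max]
    exact max_le (hle s) (hkτ s)

/-! ### The redesigned closed loop -/

section Gain

variable {ε : ℝ} {ρ : ℝ → ℝ}

theorem gain_nonneg (hε : 0 < ε) (hρpos : ∀ s, 0 ≤ s → 0 < ρ s) (s : ℝ≥0) :
    0 ≤ gain ε ρ s := by
  have := hρpos ((s : ℝ) ^ 2) (sq_nonneg _)
  unfold gain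
  positivity

theorem isClassKInf_gain (hε : 0 < ε) (hρ : ContinuousOn ρ (Ici 0)) (hρmono : MonotoneOn ρ (Ici 0))
    (hρpos : ∀ s, 0 ≤ s → 0 < ρ s) : IsClassKInf fun s : ℝ≥0 => (gain ε ρ s).toNNReal := by
  have hlow : ∀ s t : ℝ≥0, s ≤ t → 1 / 2 * ε * ρ ((s : ℝ) ^ 2) * t ≤ gain ε ρ t := by
    intro s t hst
    have hst' : (s : ℝ) ≤ t := hst
    have := hρmono (mem_Ici.2 (sq_nonneg (s : ℝ))) (mem_Ici.2 (sq_nonneg (t : ℝ))) (by gcongr)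
    unfold gain
    gcongr
  have hpos : ∀ s : ℝ≥0, 0 < 1 / 2 * ε * ρ ((s : ℝ) ^ 2) := fun s => by
    have := hρpos ((s : ℝ) ^ 2) (sq_nonneg _)
    positivity
  refine ⟨⟨continuous_real_toNNReal.comp ?_, fun s t hst => ?_, by simp [gain]⟩, ?_⟩
  · have h1 : Continuous fun s : ℝ≥0 => ρ ((s : ℝ) ^ 2) :=
      hρ.comp_continuous (by fun_prop) fun s => mem_Ici.2 (sq_nonneg _)
    exact (continuous_const.mul h1).mul NNReal.continuous_coe
  · have hlt : gain ε ρ s < gain ε ρ t :=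
      (mul_lt_mul_of_pos_left (NNReal.coe_lt_coe.2 hst) (hpos s)).trans_le (hlow s t hst.le)
    exact (Real.toNNReal_lt_toNNReal_iff ((gain_nonneg hε hρpos s).trans_lt hlt)).2 hlt
  · refine tendsto_real_toNNReal_atTop.comp (tendsto_atTop_mono (fun t => hlow 0 t zero_le) ?_)
    exact NNReal.tendsto_coe_atTop.2 tendsto_id |>.const_mul_atTop (hpos 0)

end Gain

section Control

variable {n p : ℕ} {f g : EuclideanSpace ℝ (Fin n) → EuclideanSpace ℝ (Fin n)}
  {Q : EuclideanSpace ℝ (Fin n) → ℝ} {r : ℝ} {V u : ℕ → EuclideanSpace ℝ (Fin n) → ℝ}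

/-- The derivative of `Vᵢ` along the redesigned closed loop with matched disturbance `δ`, from
`u_ro - uᵢ = e_ro + (r / 2) ρ² uᵢ₊₁` and `∇Vᵢ g = -2 r uᵢ₊₁`. -/
theorem IsPolicyIteration.fderiv_robustPolicy_eq (h : IsPolicyIteration f g Q r V u) (hr : r ≠ 0)
    (ρ : ℝ → ℝ) (uhat : EuclideanSpace ℝ (Fin n) → ℝ) (i : ℕ) (x : EuclideanSpace ℝ (Fin n))
    (δ : ℝ) :
    fderiv ℝ (V i) x (f x + (robustPolicy r ρ uhat x + δ) • g x) =
      -Q x - r * u i x ^ 2 - (r * ρ (‖x‖ ^ 2) * u (i + 1) x) ^ 2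
        - 2 * r * u (i + 1) x * (redesignError r ρ uhat (u (i + 1)) (u i) x + δ) := by
  have h1 := h.evaluation i x
  have h2 := h.improvement i x
  have h3 : fderiv ℝ (V i) x (g x) = -(2 * r) * u (i + 1) x := by rw [h2]; field_simp
  simp only [map_add, map_smul, smul_eq_mul, h3] at h1 ⊢
  simp only [robustPolicy, redesignError]
  linear_combination -h1

/-- If `e_ro` and the disturbance `δ` are both at most `γ(|x|) = ½ ε ρ |x|`, the cross term
`-2 r uᵢ₊₁ (e_ro + δ)` is absorbed by `-r² ρ² uᵢ₊₁²` up to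
`((e_ro + δ) / ρ)² ≤ ε² |x|²`, which is less than `Q(x)`. -/
theorem IsPolicyIteration.fderiv_robustPolicy_neg (h : IsPolicyIteration f g Q r V u) (hr : 0 < r)
    {ε : ℝ} (hQ : IsPosDefFun fun x => Q x - ε ^ 2 * ‖x‖ ^ 2) {ρ : ℝ → ℝ}
    (hρpos : ∀ s, 0 ≤ s → 0 < ρ s) {uhat : EuclideanSpace ℝ (Fin n) → ℝ} {i : ℕ}
    {x : EuclideanSpace ℝ (Fin n)} (hx : x ≠ 0) {δ : ℝ}
    (he : |redesignError r ρ uhat (u (i + 1)) (u i) x| ≤ gain ε ρ ‖x‖)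
    (hδ : |δ| ≤ gain ε ρ ‖x‖) :
    fderiv ℝ (V i) x (f x + (robustPolicy r ρ uhat x + δ) • g x) < 0 := by
  rw [h.fderiv_robustPolicy_eq hr.ne']
  set e := redesignError r ρ uhat (u (i + 1)) (u i) x
  have hR : 0 < ρ (‖x‖ ^ 2) := hρpos _ (sq_nonneg _)
  set R := ρ (‖x‖ ^ 2) with hRdef
  have hQx := hQ.2 x hx
  obtain ⟨a, ha⟩ : ∃ a, e + δ = R * a := ⟨(e + δ) / R, by field_simp⟩
  have ha' : |a| ≤ ε * ‖x‖ := by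
    have h1 : |e + δ| ≤ 2 * gain ε ρ ‖x‖ := (abs_add_le _ _).trans (by linarith)
    rw [ha, abs_mul, abs_of_pos hR, gain, ← hRdef] at h1
    exact le_of_mul_le_mul_left (h1.trans_eq (by ring)) hR
  have ha2 : a ^ 2 ≤ ε ^ 2 * ‖x‖ ^ 2 := by
    rw [← sq_abs a, ← mul_pow]
    exact pow_le_pow_left₀ (abs_nonneg _) ha' 2
  rw [ha]
  -- completing the square in `u (i + 1) x`
  nlinarith [sq_nonneg (r * R * u (i + 1) x + a), mul_nonneg hr.le (sq_nonneg (u i x))]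

theorem contDiffAt_robustPolicy {ρ : ℝ → ℝ} (hρ : ContDiffOn ℝ ∞ ρ (Ici 0)) {m : WithTop ℕ∞}
    (hm : m ≤ ∞) {uhat : EuclideanSpace ℝ (Fin n) → ℝ} {x : EuclideanSpace ℝ (Fin n)}
    (hu : ContDiffAt ℝ m uhat x) : ContDiffAt ℝ m (robustPolicy r ρ uhat) x := by
  have h1 : ContDiff ℝ ∞ fun y : EuclideanSpace ℝ (Fin n) => ρ (‖y‖ ^ 2) :=
    contDiffOn_univ.1 (hρ.comp (contDiff_norm_sq ℝ).contDiffOn fun y _ => sq_nonneg ‖y‖)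
  exact (contDiffAt_const.add (contDiffAt_const.mul ((h1.contDiffAt.of_le hm).pow 2))).mul hu

theorem contDiffAt_approxPolicy {m : WithTop ℕ∞} {φ : ℕ → EuclideanSpace ℝ (Fin n) → ℝ}
    {x : EuclideanSpace ℝ (Fin n)} (hφ : ∀ j, ContDiffAt ℝ m (φ j) x) (N : ℕ) (c : ℕ → ℝ) :
    ContDiffAt ℝ m (approxPolicy φ N c) x :=
  ContDiffAt.sum fun j _ => contDiffAt_const.mul (hφ j)

theorem LocallyLipschitz.smul {X F : Type*} [PseudoMetricSpace X] [NormedAddCommGroup F]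
    [NormedSpace ℝ F] {a : X → ℝ} {v : X → F} (ha : LocallyLipschitz a)
    (hv : LocallyLipschitz v) : LocallyLipschitz fun y => a y • v y := by
  have h : ContDiff ℝ 1 fun q : ℝ × F => q.1 • q.2 := contDiff_fst.smul contDiff_snd
  exact h.locallyLipschitz.comp (ha.prodMk hv)

theorem locallyLipschitzOn_closedLoop (hf : LocallyLipschitz f) (hg : LocallyLipschitz g)
    {Δw : EuclideanSpace ℝ (Fin p) × EuclideanSpace ℝ (Fin n) → EuclideanSpace ℝ (Fin p)}
    {Δ : EuclideanSpace ℝ (Fin p) × EuclideanSpace ℝ (Fin n) → ℝ}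
    (hΔw : LocallyLipschitz Δw) (hΔ : LocallyLipschitz Δ) {μ : EuclideanSpace ℝ (Fin n) → ℝ}
    {S : Set (EuclideanSpace ℝ (Fin p) × EuclideanSpace ℝ (Fin n))}
    (hμ : ∀ z ∈ S, ContDiffAt ℝ 1 μ z.2) :
    LocallyLipschitzOn S (closedLoop f g Δw Δ μ) := by
  rw [locallyLipschitzOn_iff_restrict]
  have hval : LocallyLipschitz (Subtype.val : S → _) :=
    LipschitzWith.subtype_val S |>.locallyLipschitz
  have hsnd : LocallyLipschitz fun z : S => z.1.2 :=
    LipschitzWith.prod_snd.locallyLipschitz.comp hval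
  have hμ' : LocallyLipschitz fun z : S => μ z.1.2 := by
    intro z
    obtain ⟨K, t, ht, hK⟩ := (hμ z.1 z.2).exists_lipschitzOnWith
    obtain ⟨K', t', ht', hK'⟩ := hsnd z
    refine ⟨K * K', t' ∩ (fun z : S => z.1.2) ⁻¹' t,
      inter_mem ht' (hsnd.continuous.continuousAt ht), ?_⟩
    exact hK.comp (hK'.mono inter_subset_left) fun y hy => hy.2
  exact (hΔw.comp hval).prodMk
    ((hf.comp hsnd).add ((hμ'.add (hΔ.comp hval)).smul (hg.comp hsnd)))

theorem eq_zero_of_classKInf_le {E : Type*} [NormedAddCommGroup E] {α : ℝ≥0 → ℝ≥0}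
    (hα : IsClassKInf α) {v : E → ℝ} {x : E} (hle : (α ‖x‖₊ : ℝ) ≤ v x) (hv : v x = 0) : x = 0 := by
  have h1 : α ‖x‖₊ = α 0 := by
    rw [hα.map_zero]
    exact le_antisymm (by exact_mod_cast hle.trans hv.le) zero_le
  simpa using hα.strictMono.injective h1

theorem norm_le_of_classKInf_le {E : Type*} [NormedAddCommGroup E] {α : ℝ≥0 → ℝ≥0}
    (hα : IsClassKInf α) {x : E} {m : ℝ} (hle : (α ‖x‖₊ : ℝ) ≤ m) :
    ‖x‖ ≤ Function.invFun α m.toNNReal := by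
  have h1 : α ‖x‖₊ ≤ α (Function.invFun α m.toNNReal) := by
    rw [hα.rightInverse_invFun]
    exact NNReal.le_toNNReal_of_coe_le hle
  exact_mod_cast hα.strictMono.le_iff_le.1 h1

end Control

/-- The small-gain argument. Where `σ (v x) ≤ W w`, the bound `κ₃ ≤ σ ∘ v` makes the ISS decrease
condition of `W` applicable. Where `W w ≤ σ (v x)`, the bound `κ₁ ∘ lam₁⁻¹ ∘ σ ∘ v ≤ γ` makes the
disturbance `Δ (w, x)` at most `γ(|x|)`, so that `v` decreases. -/
theorem isMaxLyapunovPair_closedLoop {n p : ℕ}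
    {f g : EuclideanSpace ℝ (Fin n) → EuclideanSpace ℝ (Fin n)}
    (hf : LocallyLipschitz f) (hg : LocallyLipschitz g)
    {Δw : EuclideanSpace ℝ (Fin p) × EuclideanSpace ℝ (Fin n) → EuclideanSpace ℝ (Fin p)}
    {Δ : EuclideanSpace ℝ (Fin p) × EuclideanSpace ℝ (Fin n) → ℝ}
    (hΔw : LocallyLipschitz Δw) (hΔ : LocallyLipschitz Δ)
    {v : EuclideanSpace ℝ (Fin n) → ℝ} (hv : ContDiff ℝ 1 v) (hv0 : v 0 = 0)
    {α : ℝ≥0 → ℝ≥0} (hα : IsClassKInf α) (hvlower : ∀ x, (α ‖x‖₊ : ℝ) ≤ v x)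
    {W : EuclideanSpace ℝ (Fin p) → ℝ} {lam₁ lam₂ κ₁ κ₂ κ₃ : ℝ≥0 → ℝ≥0}
    {κ₄ : EuclideanSpace ℝ (Fin p) → ℝ}
    (hW : IsISSUncertainty Δw Δ W lam₁ lam₂ κ₁ κ₂ κ₃ κ₄)
    {μ : EuclideanSpace ℝ (Fin n) → ℝ} {d : ℝ} (hd : 0 < d)
    (hμ : ∀ x, v x ≤ d → ContDiffAt ℝ 1 μ x)
    {γ : ℝ≥0 → ℝ≥0} (hκ₂ : ∀ s, κ₂ s ≤ γ s)
    (hdecr : ∀ x, ∀ δ : ℝ, x ≠ 0 → v x ≤ d → |δ| ≤ γ ‖x‖₊ →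
      fderiv ℝ v x (f x + (μ x + δ) • g x) < 0)
    {σ : ℝ≥0 → ℝ≥0} (hσ : IsClassKInf σ) (hκ₃ : ∀ x, κ₃ ‖x‖₊ ≤ σ (v x).toNNReal)
    (hκ₁ : ∀ x, κ₁ (Function.invFun lam₁ (σ (v x).toNNReal)) ≤ γ ‖x‖₊) :
    IsMaxLyapunovPair (closedLoop f g Δw Δ μ) σ (fun z => W z.1) (fun z => v z.2)
      (σ d.toNNReal) := by
  have hv_nonneg : ∀ x, 0 ≤ v x := fun x => (NNReal.coe_nonneg _).trans (hvlower x)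
  have hW_nonneg : ∀ w, 0 ≤ W w := fun w => (NNReal.coe_nonneg _).trans (hW.lower w)
  have hv_eq : ∀ x, v x = 0 → x = 0 := fun x => eq_zero_of_classKInf_le hα (hvlower x)
  have hW_eq : ∀ w, W w = 0 → w = 0 := fun w =>
    eq_zero_of_classKInf_le hW.classKInf_lam₁ (hW.lower w)
  have hlevel : ∀ z : EuclideanSpace ℝ (Fin p) × EuclideanSpace ℝ (Fin n),
      maxLyapunov σ (fun z => W z.1) (fun z => v z.2) z ≤ σ d.toNNReal → v z.2 ≤ d := by
    intro z hz
    have h1 : (σ (v z.2).toNNReal : ℝ) ≤ σ d.toNNReal := (le_max_left _ _).trans hz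
    exact (Real.toNNReal_le_toNNReal_iff hd.le).1
      (hσ.strictMono.le_iff_le.1 (by exact_mod_cast h1))
  have hfstC : ContDiff ℝ 1 fun z : EuclideanSpace ℝ (Fin p) × EuclideanSpace ℝ (Fin n) => W z.1 :=
    hW.contDiff.comp contDiff_fst
  have hsndC : ContDiff ℝ 1 fun z : EuclideanSpace ℝ (Fin p) × EuclideanSpace ℝ (Fin n) => v z.2 :=
    hv.comp contDiff_snd
  have hfst : ∀ z q : EuclideanSpace ℝ (Fin p) × EuclideanSpace ℝ (Fin n),
      fderiv ℝ (fun z : EuclideanSpace ℝ (Fin p) × EuclideanSpace ℝ (Fin n) => W z.1) z q =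
        fderiv ℝ W z.1 q.1 := fun z q => by
    exact DFunLike.congr_fun
      ((hW.contDiff.differentiable one_ne_zero z.1).hasFDerivAt.comp z hasFDerivAt_fst).fderiv q
  have hsnd : ∀ z q : EuclideanSpace ℝ (Fin p) × EuclideanSpace ℝ (Fin n),
      fderiv ℝ (fun z : EuclideanSpace ℝ (Fin p) × EuclideanSpace ℝ (Fin n) => v z.2) z q =
        fderiv ℝ v z.2 q.2 := fun z q => by
    exact DFunLike.congr_fun
      ((hv.differentiable one_ne_zero z.2).hasFDerivAt.comp z hasFDerivAt_snd).fderiv q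
  exact
  { classKInf := hσ
    level_pos := by
      have := hσ.strictMono (Real.toNNReal_pos.2 hd)
      rw [hσ.map_zero] at this
      exact_mod_cast this
    contDiff_left := hfstC
    contDiff_right := hsndC
    nonneg_left := fun z => hW_nonneg _
    nonneg_right := fun z => hv_nonneg _
    zero_left := hW.posDef.1
    zero_right := hv0
    eq_zero := fun z h1 h2 => Prod.ext (hW_eq _ h1) (hv_eq _ h2)
    isCompact := by
      refine Metric.isCompact_of_isClosed_isBounded (isClosed_le ?_ continuous_const) ?_
      · exact (NNReal.continuous_coe.comp (hσ.continuous.comp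
          (continuous_real_toNNReal.comp hsndC.continuous))).max hfstC.continuous
      · refine isBounded_iff_forall_norm_le.2
          ⟨max (Function.invFun lam₁ (σ d.toNNReal : ℝ).toNNReal : ℝ≥0)
            (Function.invFun α d.toNNReal : ℝ≥0), fun z hz => ?_⟩
        exact max_le_max
          (norm_le_of_classKInf_le hW.classKInf_lam₁
            ((hW.lower _).trans ((le_max_right _ _).trans hz)))
          (norm_le_of_classKInf_le hα ((hvlower _).trans (hlevel z hz)))
    locallyLipschitzOn := locallyLipschitzOn_closedLoop hf hg hΔw hΔ fun z hz => hμ _ (hlevel z hz)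
    deriv_left := by
      rintro ⟨w, x⟩ hz hM hle
      simp only at hle
      rw [hfst]
      refine (hW.decrease w x (le_trans (by exact_mod_cast hκ₃ x) hle)).trans_lt
        (neg_lt_zero.2 (hW.posDef_κ₄.2 w ?_))
      -- if `w = 0` then `σ (v x) ≤ W w = 0`, so that `x = 0` as well
      rintro rfl
      rw [hW.posDef.1] at hle
      have h1 : σ (v x).toNNReal = σ 0 := by
        rw [hσ.map_zero]
        exact le_antisymm (by exact_mod_cast hle) zero_le
      have h2 : v x ≤ 0 := Real.toNNReal_eq_zero.1 (hσ.strictMono.injective h1)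
      exact hz (Prod.ext rfl (hv_eq x (h2.antisymm (hv_nonneg x))))
    deriv_right := by
      rintro ⟨w, x⟩ hz hM hle
      simp only at hle
      rw [hsnd]
      have hx : x ≠ 0 := by
        rintro rfl
        rw [hv0, Real.toNNReal_zero, hσ.map_zero] at hle
        exact hz (Prod.ext (hW_eq w (le_antisymm hle (hW_nonneg w))) rfl)
      refine hdecr x _ hx (hlevel _ hM) ((hW.output_le w x).trans (max_le ?_ ?_))
      · have h1 : ‖w‖₊ ≤ Function.invFun lam₁ (σ (v x).toNNReal) := by
          have := norm_le_of_classKInf_le hW.classKInf_lam₁ ((hW.lower w).trans hle)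
          rw [Real.toNNReal_coe] at this
          exact_mod_cast this
        exact_mod_cast (hW.classK_κ₁.strictMono.monotone h1).trans (hκ₁ x)
      · exact_mod_cast hκ₂ _ }

theorem theorem3p2 {n p : ℕ}
    -- the system `ẇ = Δ_w(w, x)`, `ẋ = f(x) + g(x) [u + Δ(w, x)]`
    (f g : EuclideanSpace ℝ (Fin n) → EuclideanSpace ℝ (Fin n))
    (hf : LocallyLipschitz f) (hg : LocallyLipschitz g)
    (Δw : EuclideanSpace ℝ (Fin p) × EuclideanSpace ℝ (Fin n) → EuclideanSpace ℝ (Fin p))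
    (Δ : EuclideanSpace ℝ (Fin p) × EuclideanSpace ℝ (Fin n) → ℝ)
    (hΔw : LocallyLipschitz Δw) (hΔ : LocallyLipschitz Δ)
    -- the cost and the policy iteration
    (Q : EuclideanSpace ℝ (Fin n) → ℝ) (r : ℝ) (hr : 0 < r)
    (V u : ℕ → EuclideanSpace ℝ (Fin n) → ℝ) (hVu : IsPolicyIteration f g Q r V u)
    -- bounds on the value functions, and positive definiteness of `Q - ε²|x|²`
    (α₁ α₂ : ℝ≥0 → ℝ≥0) (hα₁ : IsClassKInf α₁) (hα₂ : IsClassKInf α₂)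
    (hVlower : ∀ i x, (α₁ ‖x‖₊ : ℝ) ≤ V i x) (hVupper : ∀ i x, V i x ≤ (α₂ ‖x‖₊ : ℝ))
    (ε : ℝ) (hε : 0 < ε) (hQ : IsPosDefFun (fun x => Q x - ε ^ 2 * ‖x‖ ^ 2))
    -- the dynamic uncertainty
    (W : EuclideanSpace ℝ (Fin p) → ℝ) (lam₁ lam₂ κ₁ κ₂ κ₃ : ℝ≥0 → ℝ≥0)
    (κ₄ : EuclideanSpace ℝ (Fin p) → ℝ)
    (hW : IsISSUncertainty Δw Δ W lam₁ lam₂ κ₁ κ₂ κ₃ κ₄)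
    -- the function `ρ` of the redesign
    (ρ : ℝ → ℝ) (hρ : ContDiffOn ℝ ∞ ρ (Ici 0)) (hρmono : MonotoneOn ρ (Ici 0))
    (hρpos : ∀ s, 0 ≤ s → 0 < ρ s)
    -- the index `i*`, the level `d`, and the approximate policy on the approximation domain `Ω`
    (iStar : ℕ) (d : ℝ) (hd : 0 < d)
    (Ω : Set (EuclideanSpace ℝ (Fin n))) (hΩ : {x | V iStar x ≤ d} ⊆ Ω)
    (φ : ℕ → EuclideanSpace ℝ (Fin n) → ℝ) (hφ : ∀ j, ∀ x ∈ Ω, ContDiffAt ℝ ∞ (φ j) x)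
    (hφ0 : ∀ j, φ j 0 = 0) (N : ℕ) (c : ℕ → ℝ)
    -- the gain condition
    (hgain : ∀ s : ℝ≥0, 0 < s →
      max (κ₂ s : ℝ)
        ((κ₁ ∘ Function.invFun lam₁ ∘ κ₃ ∘ Function.invFun α₁ ∘ α₂) s : ℝ) < gain ε ρ s)
    -- the error condition
    (herr : ∀ x, 0 < V iStar x → V iStar x ≤ d →
      |redesignError r ρ (approxPolicy φ N c) (u (iStar + 1)) (u iStar) x| < gain ε ρ ‖x‖) :
    IsAsymptoticallyStable
        (closedLoop f g Δw Δ (robustPolicy r ρ (approxPolicy φ N c))) ∧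
      ∃ σ : ℝ≥0 → ℝ≥0, IsClassKInf σ ∧
        {z : EuclideanSpace ℝ (Fin p) × EuclideanSpace ℝ (Fin n) |
            max (σ (V iStar z.2).toNNReal : ℝ) (W z.1) ≤ (σ d.toNNReal : ℝ)} ⊆
          regionOfAttraction
            (closedLoop f g Δw Δ (robustPolicy r ρ (approxPolicy φ N c))) := by
  have hγ := isClassKInf_gain hε hρ.continuousOn hρmono hρpos
  set γ : ℝ≥0 → ℝ≥0 := fun s => (gain ε ρ s).toNNReal with hγdef
  have hγ_coe : ∀ s : ℝ≥0, (γ s : ℝ) = gain ε ρ s := fun s =>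
    Real.coe_toNNReal _ (gain_nonneg hε hρpos s)
  -- the two halves of the gain condition, extended to `s = 0`, where both sides vanish
  have hκ₂ : ∀ s, κ₂ s ≤ γ s := fun s => by
    rcases eq_zero_or_pos s with rfl | hs
    · rw [hW.classK_κ₂.map_zero]
      exact zero_le
    · have := ((le_max_left _ _).trans_lt (hgain s hs)).le
      rw [← hγ_coe] at this
      exact_mod_cast this
  have hh : IsClassK (κ₃ ∘ Function.invFun α₁) := hW.classK_κ₃.comp hα₁.invFun.toIsClassK
  have hk : IsClassK (κ₁ ∘ Function.invFun lam₁) :=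
    hW.classK_κ₁.comp hW.classKInf_lam₁.invFun.toIsClassK
  have hsmall : ∀ s, (κ₁ ∘ Function.invFun lam₁) ((κ₃ ∘ Function.invFun α₁) s) ≤
      (γ ∘ Function.invFun α₂) s := fun s => by
    obtain ⟨t, rfl⟩ := hα₂.bijective.surjective s
    rw [Function.comp_apply (f := γ), hα₂.leftInverse_invFun]
    rcases eq_zero_or_pos t with rfl | ht
    · rw [hα₂.map_zero, hh.map_zero, hk.map_zero]
      exact zero_le
    · have := ((le_max_right _ _).trans_lt (hgain t ht)).le
      rw [← hγ_coe] at this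
      exact_mod_cast this
  obtain ⟨σ, hσ, hσh, hσk⟩ := exists_isClassKInf_ge_of_comp_le hh hk (hγ.comp hα₂.invFun) hsmall
  have hV_pos : ∀ x, x ≠ 0 → 0 < V iStar x := fun x hx => by
    refine ((NNReal.coe_nonneg _).trans (hVlower iStar x)).lt_of_ne fun h0 => hx ?_
    exact eq_zero_of_classKInf_le hα₁ (hVlower iStar x) h0.symm
  have hpair := isMaxLyapunovPair_closedLoop hf hg hΔw hΔ (hVu.contDiff iStar)
    (hVu.map_zero iStar) hα₁ (hVlower iStar) hW hd
    (μ := robustPolicy r ρ (approxPolicy φ N c))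
    (fun x hx => contDiffAt_robustPolicy hρ (by exact_mod_cast le_top)
      (contDiffAt_approxPolicy (fun j => (hφ j x (hΩ hx)).of_le (by exact_mod_cast le_top)) N c))
    hκ₂
    (fun x δ hx hxd hδ => hVu.fderiv_robustPolicy_neg hr hQ hρpos hx
      (herr x (hV_pos x hx) hxd).le (by rwa [hγ_coe] at hδ))
    hσ
    (fun x => by
      refine le_trans ?_ (hσh _)
      refine hW.classK_κ₃.strictMono.monotone ?_
      rw [← hα₁.leftInverse_invFun ‖x‖₊]
      exact hα₁.invFun.strictMono.monotone (NNReal.le_toNNReal_of_coe_le (hVlower iStar x)))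
    (fun x => by
      refine (hσk _).trans (hγ.strictMono.monotone ?_)
      rw [← hα₂.leftInverse_invFun ‖x‖₊]
      exact hα₂.invFun.strictMono.monotone (Real.toNNReal_le_iff_le_coe.2 (hVupper iStar x)))
  exact ⟨hpair.isAsymptoticallyStable, σ, hσ, hpair.subset_regionOfAttraction⟩
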